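/- For $k\ge 0$ let $p_k$ be the number of partitions of $k$ (so $p_0=1$), and let $$s_n(x)=\sum_{k=0}^n p_k x^k$$ be the Taylor polynomials of $P(x)=\prod_{m\ge1}(1-x^m)^{-1}=\sum_{k\ge0}p_kx^k$. For $n\ge 1$ put $\lambda_n=\sqrt{n-1/24}$, and let $a=\pi\sqrt{2/3}$. **Theorem.** Let $\delta>0$. There is a constant $C$, depending only on $\delta$, such that for all $0<\eta<1/2$, all integers $n\ge 1$ and all complex $x$ with $|x|\ge 1+\delta$, $$s_n(x)=\frac{x^{n+1}}{x-1}\,\frac{e^{a\lambda_n}\lambda_n^{-2}}{4\sqrt3}\,\bigl(1+E_n(x)\bigr),\qquad |E_n(x)|\le C\,\lambda_n^{-\eta}.$$ In other words, the error factor is $1+O_\delta(\lambda_n^{-\eta})$ uniformly in $|x|\ge 1+\delta$. -/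

import Mathlib

/-- The number of partitions of `k`; `partitionNumber 0 = 1`. -/
def partitionNumber (k : ℕ) : ℕ := Fintype.card (Nat.Partition k)

/-- The Taylor polynomial `s_n(x) = ∑_{k=0}^n p_k x^k` of the generating function of the
partition numbers. -/
noncomputable def partitionTaylor (n : ℕ) : Polynomial ℂ :=
  ∑ k ∈ Finset.range (n + 1), Polynomial.C (partitionNumber k : ℂ) * Polynomial.X ^ k

/-- The constant `a = π √(2/3)`. -/
noncomputable def hrConst : ℝ := Real.pi * Real.sqrt (2 / 3)

/-- `λ_n = √(n - 1/24)`, used for `n ≥ 1`. -/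
noncomputable def hrLambda (n : ℕ) : ℝ := Real.sqrt ((n : ℝ) - 1 / 24)

open Filter Topology Finset MeasureTheory

/-! Summation by parts gives (x-1) s_n(x) = p_n x^(n+1) - 1 - ∑_{k<n} (p_{k+1} - p_k) x^(k+1)
(`sub_one_mul_eval_partitionTaylor`). Divided by x^(n+1), the sum has weights x^(-(n-k)), which
decay geometrically for |x| ≥ 1+δ. So it suffices that p_n equals the main term M_n = `hrMain n` up
to relative error O(λ_n^(-1/2)), and that p_{k+1} - p_k = O(λ_{k+1}^(-1/2) M_{k+1}); the latter
follows from the former because M_n itself varies slowly. Replacing λ_{k+1} by λ_n costs only a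
factor n-k, which the convergent series ∑ j ρ^j with ρ = 1/(1+δ) absorbs.

The asymptotics of p_n come from Cauchy's formula on |x| = e^(-t) with t = a/(2λ_n), the saddle
point. Near x = 1 the modular transformation of η (`partitionGen_transform`) turns the integrand
into a Gaussian with small relative corrections (`exists_norm_major_arc_le`). Elsewhere, comparing
the factors of the Euler product with those at |x| gives exponential decay
(`norm_partitionGen_minor_arc_le`). The two arcs are combined in `exists_norm_integral_sub_le`. -/

/-! ### Partitions with bounded parts and finite Euler products -/

/-- The number of partitions of `k` all of whose parts are at most `N`. -/
def boundedPartitionNumber (N k : ℕ) : ℕ := (Nat.Partition.restricted k (· ≤ N)).card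

lemma boundedPartitionNumber_le (N k : ℕ) : boundedPartitionNumber N k ≤ partitionNumber k :=
  Finset.card_le_univ _

lemma boundedPartitionNumber_of_le {N k : ℕ} (h : k ≤ N) :
    boundedPartitionNumber N k = partitionNumber k := by
  unfold boundedPartitionNumber partitionNumber Nat.Partition.restricted
  rw [Finset.filter_true_of_mem, Finset.card_univ]
  intro p _ i hi
  have := Multiset.le_sum_of_mem hi
  rw [p.parts_sum] at this
  exact this.trans h

lemma boundedPartitionNumber_zero_right (N : ℕ) : boundedPartitionNumber N 0 = 1 := by
  rw [boundedPartitionNumber_of_le (Nat.zero_le _)]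
  simp [partitionNumber]

lemma boundedPartitionNumber_zero_succ (k : ℕ) : boundedPartitionNumber 0 (k + 1) = 0 := by
  unfold boundedPartitionNumber Nat.Partition.restricted
  rw [Finset.card_eq_zero, Finset.filter_eq_empty_iff]
  intro p _ h
  have h0 : p.parts = 0 := by
    rw [Multiset.eq_zero_iff_forall_notMem]
    intro a ha
    exact absurd (p.parts_pos ha) (by simpa using h a ha)
  simpa [h0] using p.parts_sum

open scoped PowerSeries.WithPiTopology in
lemma mk_boundedPartitionNumber_eq_prod (N : ℕ) :
    (PowerSeries.mk fun k ↦ (boundedPartitionNumber N k : ℝ)) =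
      ∏ i ∈ range N, ∑' j : ℕ, (PowerSeries.X : PowerSeries ℝ) ^ ((i + 1) * j) := by
  have h := Nat.Partition.hasProd_powerSeriesMk_card_restricted ℝ (· ≤ N)
  have h2 := hasProd_prod_of_ne_finset_one (L := SummationFilter.unconditional ℕ) (s := range N)
    (f := fun i ↦ if i + 1 ≤ N then ∑' j : ℕ, (PowerSeries.X : PowerSeries ℝ) ^ ((i + 1) * j)
      else 1) (by
      intro b hb
      rw [if_neg]
      simpa using hb)
  rw [show (PowerSeries.mk fun k ↦ (boundedPartitionNumber N k : ℝ)) = _ from h.unique h2]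
  refine Finset.prod_congr rfl fun i hi ↦ if_pos ?_
  simpa using hi

open scoped PowerSeries.WithPiTopology in
lemma mk_boundedPartitionNumber_succ (N : ℕ) :
    (PowerSeries.mk fun k ↦ (boundedPartitionNumber (N + 1) k : ℝ)) * (1 - PowerSeries.X ^ (N + 1))
      = PowerSeries.mk fun k ↦ (boundedPartitionNumber N k : ℝ) := by
  rw [mk_boundedPartitionNumber_eq_prod, mk_boundedPartitionNumber_eq_prod, prod_range_succ,
    mul_assoc]
  simp_rw [pow_mul]
  rw [PowerSeries.WithPiTopology.tsum_pow_mul_one_sub_of_constantCoeff_eq_zero (by simp), mul_one]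

lemma boundedPartitionNumber_succ_of_lt {N k : ℕ} (h : k < N + 1) :
    boundedPartitionNumber (N + 1) k = boundedPartitionNumber N k := by
  have := congrArg (PowerSeries.coeff k) (mk_boundedPartitionNumber_succ N)
  rw [mul_sub, mul_one, map_sub, PowerSeries.coeff_mul_X_pow', if_neg (by omega)] at this
  simpa using this

lemma boundedPartitionNumber_succ_add (N k : ℕ) :
    boundedPartitionNumber (N + 1) (k + (N + 1)) =
      boundedPartitionNumber N (k + (N + 1)) + boundedPartitionNumber (N + 1) k := by
  have := congrArg (PowerSeries.coeff (k + (N + 1))) (mk_boundedPartitionNumber_succ N)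
  rw [mul_sub, mul_one, map_sub, PowerSeries.coeff_mul_X_pow, sub_eq_iff_eq_add] at this
  simp only [PowerSeries.coeff_mk] at this
  exact_mod_cast this

/-- A crude polynomial bound is enough: it serves only to make the bounded-part series converge
absolutely on the open unit disc. -/
lemma boundedPartitionNumber_le_pow (N k : ℕ) : boundedPartitionNumber N k ≤ (k + 1) ^ N := by
  induction N generalizing k with
  | zero =>
    rcases k with _ | k
    · simp [boundedPartitionNumber_zero_right]
    · simp [boundedPartitionNumber_zero_succ]
  | succ N ih =>
    induction k using Nat.strong_induction_on with
    | _ k ihk =>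
      rcases lt_or_ge k (N + 1) with h | h
      · rw [boundedPartitionNumber_succ_of_lt h]
        exact (ih k).trans (Nat.pow_le_pow_right (by omega) (by omega))
      · obtain ⟨l, rfl⟩ := Nat.exists_eq_add_of_le' h
        rw [boundedPartitionNumber_succ_add]
        have h1 := ih (l + (N + 1))
        have h2 := ihk l (by omega)
        have h3 : (l + 1) ^ (N + 1) ≤ (l + (N + 1) + 1) ^ N * (l + (N + 1)) := by
          rw [pow_succ]
          gcongr <;> omega
        calc _ ≤ (l + (N + 1) + 1) ^ N + (l + (N + 1) + 1) ^ N * (l + (N + 1)) := by omega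
          _ = _ := by ring

lemma summable_norm_boundedPartitionNumber {x : ℂ} (hx : ‖x‖ < 1) (N : ℕ) :
    Summable fun k ↦ ‖(boundedPartitionNumber N k : ℂ) * x ^ k‖ := by
  have h := (summable_nat_add_iff 1).mpr
    (summable_norm_pow_mul_geometric_of_norm_lt_one (R := ℂ) N (r := ((1 + ‖x‖) / 2 : ℝ)) (by
      rw [Complex.norm_real, Real.norm_of_nonneg (by positivity)]; linarith))
  refine Summable.of_nonneg_of_le (fun _ ↦ norm_nonneg _) (fun k ↦ ?_)
    (h.mul_left ((1 + ‖x‖) / 2)⁻¹)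
  have h0 : (0 : ℝ) < (1 + ‖x‖) / 2 := by positivity
  simp only [norm_mul, norm_pow, Complex.norm_natCast, Complex.norm_real,
    Real.norm_of_nonneg h0.le]
  rw [pow_succ ((1 + ‖x‖) / 2)]
  field_simp
  have h1 : (boundedPartitionNumber N k : ℝ) ≤ ((k + 1 : ℕ) : ℝ) ^ N := by
    exact_mod_cast boundedPartitionNumber_le_pow N k
  gcongr
  linarith

lemma tsum_mul_one_sub_pow {a b : ℕ → ℂ} {x : ℂ} {m : ℕ} (ha : Summable fun k ↦ a k * x ^ k)
    (hb : Summable fun k ↦ b k * x ^ k) (h1 : ∀ k < m, a k = b k)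
    (h2 : ∀ k, a (k + m) = b (k + m) + a k) :
    (∑' k, a k * x ^ k) * (1 - x ^ m) = ∑' k, b k * x ^ k := by
  have h3 : ∑' k, (a k * x ^ k - b k * x ^ k) = (∑' k, a k * x ^ k) * x ^ m := by
    rw [← (ha.sub hb).sum_add_tsum_nat_add m, sum_eq_zero, zero_add, ← tsum_mul_right]
    · refine tsum_congr fun k ↦ ?_
      rw [h2]
      ring
    · intro k hk
      rw [h1 k (by simpa using hk), sub_self]
  rw [ha.tsum_sub hb] at h3
  linear_combination h3

lemma tsum_boundedPartitionNumber {x : ℂ} (hx : ‖x‖ < 1) (N : ℕ) :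
    (∑' k, (boundedPartitionNumber N k : ℂ) * x ^ k) * ∏ i ∈ range N, (1 - x ^ (i + 1)) = 1 := by
  induction N with
  | zero =>
    rw [tsum_eq_single 0]
    · simp [boundedPartitionNumber_zero_right]
    · rintro (_ | k) hk
      · simp at hk
      · simp [boundedPartitionNumber_zero_succ]
  | succ N ih =>
    have hs := fun M ↦ (summable_norm_boundedPartitionNumber hx M).of_norm
    have key : (∑' k, (boundedPartitionNumber (N + 1) k : ℂ) * x ^ k) * (1 - x ^ (N + 1)) =
        ∑' k, (boundedPartitionNumber N k : ℂ) * x ^ k := by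
      refine tsum_mul_one_sub_pow (hs (N + 1)) (hs N) (fun k hk ↦ ?_) fun k ↦ ?_
      · rw [boundedPartitionNumber_succ_of_lt hk]
      · rw [boundedPartitionNumber_succ_add, Nat.cast_add]
    rw [prod_range_succ, mul_comm (∏ i ∈ range N, _), ← mul_assoc, key, ih]

/-! ### The generating function as the inverse of Euler's product -/

/-- Euler's product `∏ (1 - x ^ m)`, the reciprocal of the generating function of partitions. -/
noncomputable def eulerProduct (x : ℂ) : ℂ := ∏' n : ℕ, (1 - x ^ (n + 1))

/-- The generating function of the partition numbers. -/
noncomputable def partitionGen (x : ℂ) : ℂ := ∑' k, (partitionNumber k : ℂ) * x ^ k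

lemma tendsto_prod_eulerProduct {x : ℂ} (hx : ‖x‖ < 1) :
    Tendsto (fun N ↦ ∏ i ∈ range N, (1 - x ^ (i + 1))) atTop (𝓝 (eulerProduct x)) :=
  (ModularForm.multipliable_one_sub_pow hx).hasProd.tendsto_prod_nat

lemma eulerProduct_ne_zero {x : ℂ} (hx : ‖x‖ < 1) : eulerProduct x ≠ 0 := by
  have h : eulerProduct x = ∏' n : ℕ, (1 + -x ^ (n + 1)) := by
    simp [eulerProduct, sub_eq_add_neg]
  rw [h]
  refine tprod_one_add_ne_zero_of_summable (fun i h ↦ ?_) ?_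
  · have h1 : x ^ (i + 1) = 1 := by linear_combination -h
    have h2 : ‖x‖ ^ (i + 1) < 1 := pow_lt_one₀ (norm_nonneg _) hx (by omega)
    rw [← norm_pow, h1] at h2
    simp at h2
  · simpa using (summable_nat_add_iff 1).mpr (summable_geometric_of_lt_one (norm_nonneg _) hx)

/-- The partial sum below K only sees partitions with parts at most K, so it is dominated by the
inverse of the K-th finite Euler product. These inverses converge, hence are bounded. -/
lemma summable_partitionNumber_real {r : ℝ} (h0 : 0 ≤ r) (h1 : r < 1) :
    Summable fun k ↦ (partitionNumber k : ℝ) * r ^ k := by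
  have hr : ‖(r : ℂ)‖ < 1 := by rwa [Complex.norm_real, Real.norm_of_nonneg h0]
  have hlim := ((tendsto_prod_eulerProduct hr).inv₀ (eulerProduct_ne_zero hr)).norm
  obtain ⟨M, hM⟩ := hlim.bddAbove_range
  refine summable_of_sum_range_le (c := M) (fun k ↦ by positivity) fun K ↦ ?_
  refine le_trans ?_ (hM ⟨K, rfl⟩)
  have hs := summable_norm_boundedPartitionNumber hr K
  have e : (fun k ↦ ‖(boundedPartitionNumber K k : ℂ) * (r : ℂ) ^ k‖) =
      fun k ↦ (boundedPartitionNumber K k : ℝ) * r ^ k := by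
    ext k; simp [abs_of_nonneg h0]
  rw [e] at hs
  have h2 : (∏ i ∈ range K, (1 - (r : ℂ) ^ (i + 1)))⁻¹ =
      ((∑' k, (boundedPartitionNumber K k : ℝ) * r ^ k : ℝ) : ℂ) := by
    rw [← eq_comm, Complex.ofReal_tsum]
    push_cast
    exact eq_inv_of_mul_eq_one_left (tsum_boundedPartitionNumber hr K)
  dsimp only
  rw [h2, Complex.norm_real, Real.norm_of_nonneg (tsum_nonneg fun _ ↦ by positivity)]
  refine le_trans (le_of_eq ?_) (hs.sum_le_tsum (range K) fun _ _ ↦ by positivity)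
  refine sum_congr rfl fun k hk ↦ ?_
  rw [boundedPartitionNumber_of_le (by simp at hk; omega)]

lemma summable_norm_partitionNumber {x : ℂ} (hx : ‖x‖ < 1) :
    Summable fun k ↦ ‖(partitionNumber k : ℂ) * x ^ k‖ := by
  simpa using summable_partitionNumber_real (norm_nonneg x) hx

lemma partitionGen_eq_inv {x : ℂ} (hx : ‖x‖ < 1) : partitionGen x = (eulerProduct x)⁻¹ := by
  have h1 : Tendsto (fun N ↦ ∑' k, (boundedPartitionNumber N k : ℂ) * x ^ k) atTop
      (𝓝 (partitionGen x)) := by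
    refine tendsto_tsum_of_dominated_convergence (summable_norm_partitionNumber hx) ?_ ?_
    · intro k
      refine tendsto_const_nhds.congr' ?_
      filter_upwards [eventually_ge_atTop k] with N hN
      rw [boundedPartitionNumber_of_le hN]
    · refine Eventually.of_forall fun N k ↦ ?_
      simp only [norm_mul, Complex.norm_natCast]
      gcongr
      exact_mod_cast boundedPartitionNumber_le N k
  have h2 := h1.mul (tendsto_prod_eulerProduct hx)
  simp_rw [tsum_boundedPartitionNumber hx] at h2
  exact eq_inv_of_mul_eq_one_left (tendsto_nhds_unique h2 tendsto_const_nhds)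

/-! ### Modular transformation of the generating function -/

lemma Complex.sqrt_I_mul {w : ℂ} (hw : 0 < w.re) :
    (Complex.I * w).sqrt = Complex.I.sqrt * w.sqrt := by
  have hw0 : w ≠ 0 := by rintro rfl; simp at hw
  have harg := abs_lt.mp (Complex.abs_arg_lt_pi_div_two_iff.mpr (Or.inl hw))
  have hlog : Complex.log (Complex.I * w) = Complex.log Complex.I + Complex.log w := by
    refine Complex.log_mul Complex.I_ne_zero hw0 ?_
    rw [Complex.arg_I]
    constructor <;> linarith [harg.1, harg.2, Real.pi_pos]
  rw [sqrt_eq_exp (mul_ne_zero Complex.I_ne_zero hw0), sqrt_eq_exp Complex.I_ne_zero,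
    sqrt_eq_exp hw0, hlog, add_div, Complex.exp_add]

lemma eta_eq_exp_mul_eulerProduct (τ : ℂ) :
    ModularForm.eta (Complex.I * (τ / (2 * Real.pi))) =
      Complex.exp (-τ / 24) * eulerProduct (Complex.exp (-τ)) := by
  have hpi : (Real.pi : ℂ) ≠ 0 := Complex.ofReal_ne_zero.mpr Real.pi_ne_zero
  have h : 2 * Real.pi * Complex.I * (Complex.I * (τ / (2 * Real.pi))) = -τ := by
    field_simp
    rw [Complex.I_sq]
    ring
  unfold ModularForm.eta eulerProduct
  simp only [ModularForm.eta_q_eq_pow, h]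
  rw [Function.Periodic.qParam, h]
  norm_num

lemma norm_exp_neg_lt_one {τ : ℂ} (hτ : 0 < τ.re) : ‖Complex.exp (-τ)‖ < 1 := by
  rw [Complex.norm_exp, Complex.neg_re]
  exact Real.exp_zero ▸ Real.exp_lt_exp.mpr (by linarith)

lemma re_const_div_pos {τ : ℂ} (hτ : 0 < τ.re) {c : ℝ} (hc : 0 < c) : 0 < ((c : ℂ) / τ).re := by
  have hτ0 : τ ≠ 0 := by rintro rfl; simp at hτ
  rw [div_eq_mul_inv, Complex.re_ofReal_mul, Complex.inv_re]
  have := Complex.normSq_pos.mpr hτ0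
  positivity

/-- This is η(-1/z) versus η(z) at z = iτ/(2π); the factor √i of the transformation law cancels
against the one split off from √z. -/
lemma partitionGen_transform {τ : ℂ} (hτ : 0 < τ.re) :
    partitionGen (Complex.exp (-τ)) = (τ / (2 * Real.pi)).sqrt *
      Complex.exp ((Real.pi ^ 2 / 6 : ℝ) / τ - τ / 24) *
        partitionGen (Complex.exp (-((4 * Real.pi ^ 2 : ℝ) / τ))) := by
  have hpi : (Real.pi : ℂ) ≠ 0 := Complex.ofReal_ne_zero.mpr Real.pi_ne_zero
  have hτ0 : τ ≠ 0 := by rintro rfl; simp at hτ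
  have hre : 0 < (τ / (2 * Real.pi)).re := by
    rw [show τ / (2 * Real.pi : ℂ) = ((1 / (2 * Real.pi) : ℝ) : ℂ) * τ by push_cast; ring,
      Complex.re_ofReal_mul]
    positivity
  have hmem : Complex.I * (τ / (2 * Real.pi)) ∈ UpperHalfPlane.upperHalfPlaneSet := by
    simpa [UpperHalfPlane.upperHalfPlaneSet, Complex.mul_im] using hre
  have h := ModularForm.eta_comp_eq_csqrt_I_inv hmem
  simp only [Function.comp_apply, Pi.smul_apply, Pi.mul_apply, smul_eq_mul] at h
  rw [Complex.sqrt_I_mul hre] at h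
  have hinv : -1 / (Complex.I * (τ / (2 * Real.pi))) =
      Complex.I * (((4 * Real.pi ^ 2 : ℝ) / τ) / (2 * Real.pi)) := by
    push_cast
    field_simp
    rw [Complex.I_sq]
    ring
  rw [hinv, eta_eq_exp_mul_eulerProduct, eta_eq_exp_mul_eulerProduct] at h
  have hsI : Complex.I.sqrt ≠ 0 := by
    rw [sqrt_eq_exp Complex.I_ne_zero]
    exact Complex.exp_ne_zero _
  rw [mul_assoc, inv_mul_cancel_left₀ hsI] at h
  have hq1 := norm_exp_neg_lt_one hτ
  have hq2 := norm_exp_neg_lt_one (re_const_div_pos hτ (c := 4 * Real.pi ^ 2) (by positivity))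
  rw [partitionGen_eq_inv hq1, partitionGen_eq_inv hq2]
  have e1 := eulerProduct_ne_zero hq1
  have e2 := eulerProduct_ne_zero hq2
  rw [show (Real.pi ^ 2 / 6 : ℝ) / τ - τ / 24 = -τ / 24 - (-((4 * Real.pi ^ 2 : ℝ) / τ) / 24) by
    push_cast; ring, Complex.exp_sub]
  have e3 := Complex.exp_ne_zero (-((4 * Real.pi ^ 2 : ℝ) / τ) / 24)
  generalize Complex.exp (-((4 * Real.pi ^ 2 : ℝ) / τ) / 24) = A at *
  generalize Complex.exp (-τ / 24) = B at *
  field_simp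
  linear_combination h

lemma exists_norm_partitionGen_sub_one_le :
    ∃ M : ℝ, 0 < M ∧ ∀ q : ℂ, ‖q‖ ≤ 1 / 2 → ‖partitionGen q - 1‖ ≤ M * ‖q‖ := by
  have hs := (summable_nat_add_iff 1).mpr
    (summable_partitionNumber_real (r := 1 / 2) (by norm_num) (by norm_num))
  refine ⟨2 * (∑' k, (partitionNumber (k + 1) : ℝ) * (1 / 2) ^ (k + 1)) + 1, ?_, fun q hq ↦ ?_⟩
  · have : 0 ≤ ∑' k, (partitionNumber (k + 1) : ℝ) * (1 / 2) ^ (k + 1) :=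
      tsum_nonneg fun k ↦ by positivity
    positivity
  have hq1 : ‖q‖ < 1 := by linarith
  have h0 : partitionGen q - 1 = ∑' k, (partitionNumber (k + 1) : ℂ) * q ^ (k + 1) := by
    rw [partitionGen, (summable_norm_partitionNumber hq1).of_norm.tsum_eq_zero_add]
    simp [partitionNumber]
  rw [h0]
  have hb : ∀ k, ‖(partitionNumber (k + 1) : ℂ) * q ^ (k + 1)‖ ≤
      (partitionNumber (k + 1) : ℝ) * (1 / 2) ^ (k + 1) * (2 * ‖q‖) := by
    intro k
    have : ‖q‖ ^ (k + 1) ≤ (1 / 2) ^ (k + 1) * (2 * ‖q‖) := by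
      rw [pow_succ, pow_succ]
      have : ‖q‖ ^ k ≤ (1 / 2) ^ k := by gcongr
      nlinarith [norm_nonneg q]
    rw [norm_mul, norm_pow, Complex.norm_natCast, mul_assoc]
    gcongr
  refine (tsum_of_norm_bounded ((hs.mul_right _).hasSum) hb).trans ?_
  rw [tsum_mul_right]
  nlinarith [norm_nonneg q]

/-! ### Cauchy's formula on the circle of radius exp(-t) -/

lemma integral_exp_int_mul (t : ℝ) (m : ℤ) :
    ∫ θ in (-Real.pi)..Real.pi, Complex.exp (m * (t + θ * Complex.I)) =
      (if m = 0 then 2 * Real.pi else 0 : ℂ) := by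
  split_ifs with h
  · subst h
    simp
    ring
  · have hc : (m : ℂ) * Complex.I ≠ 0 := mul_ne_zero (Int.cast_ne_zero.mpr h) Complex.I_ne_zero
    have : ∀ θ : ℝ, Complex.exp (m * (t + θ * Complex.I)) =
        Complex.exp (m * t) * Complex.exp (m * Complex.I * θ) := fun θ ↦ by
      rw [← Complex.exp_add]; ring_nf
    simp_rw [this]
    rw [intervalIntegral.integral_const_mul, integral_exp_mul_complex hc]
    have : Complex.exp (m * Complex.I * (Real.pi : ℝ)) =
        Complex.exp (m * Complex.I * (-Real.pi : ℝ)) := by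
      rw [Complex.exp_eq_exp_iff_exists_int]
      exact ⟨m, by push_cast; ring⟩
    rw [this]
    simp

lemma partitionNumber_eq_integral {t : ℝ} (ht : 0 < t) (n : ℕ) :
    (partitionNumber n : ℂ) * (2 * Real.pi) =
      ∫ θ in (-Real.pi)..Real.pi, partitionGen (Complex.exp (-(t + θ * Complex.I))) *
        Complex.exp (n * (t + θ * Complex.I)) := by
  have hr : Real.exp (-t) < 1 := Real.exp_zero ▸ Real.exp_lt_exp.mpr (by linarith)
  have hs := (summable_partitionNumber_real (Real.exp_pos (-t)).le hr).mul_right (Real.exp (n * t))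
  have hnorm : ∀ θ : ℝ, ‖Complex.exp (-(t + θ * Complex.I))‖ = Real.exp (-t) := fun θ ↦ by
    simp [Complex.norm_exp]
  have H := intervalIntegral.hasSum_integral_of_dominated_convergence (μ := MeasureTheory.volume)
    (a := -Real.pi) (b := Real.pi)
    (F := fun k (θ : ℝ) ↦ (partitionNumber k : ℂ) * Complex.exp (-(t + θ * Complex.I)) ^ k *
      Complex.exp (n * (t + θ * Complex.I)))
    (f := fun θ ↦ partitionGen (Complex.exp (-(t + θ * Complex.I))) *
        Complex.exp (n * (t + θ * Complex.I)))
    (fun k _ ↦ (partitionNumber k : ℝ) * Real.exp (-t) ^ k * Real.exp (n * t))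
    (fun k ↦ by fun_prop) (fun k ↦ Eventually.of_forall fun θ _ ↦ by
      rw [norm_mul, norm_mul, norm_pow, hnorm, Complex.norm_natCast]
      simp [Complex.norm_exp])
    (Eventually.of_forall fun θ _ ↦ hs) (by simp)
    (Eventually.of_forall fun θ _ ↦ (summable_norm_partitionNumber (by rw [hnorm]; exact hr)
      ).of_norm.hasSum.mul_right _)
  refine HasSum.unique ?_ H
  have hk : ∀ k : ℕ, ∫ θ in (-Real.pi)..Real.pi, (partitionNumber k : ℂ) *
      Complex.exp (-(t + θ * Complex.I)) ^ k * Complex.exp (n * (t + θ * Complex.I)) =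
      if k = n then (partitionNumber n : ℂ) * (2 * Real.pi) else 0 := by
    intro k
    have : ∀ θ : ℝ, (partitionNumber k : ℂ) *
      Complex.exp (-(t + θ * Complex.I)) ^ k * Complex.exp (n * (t + θ * Complex.I)) =
      (partitionNumber k : ℂ) * Complex.exp (((n - k : ℤ) : ℂ) * (t + θ * Complex.I)) := fun θ ↦ by
      rw [← Complex.exp_nat_mul, mul_assoc, ← Complex.exp_add]
      push_cast
      ring_nf
    simp_rw [this]
    rw [intervalIntegral.integral_const_mul, integral_exp_int_mul]
    by_cases h : k = n
    · simp [h]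
    · rw [if_neg (by omega), if_neg h, mul_zero]
  simp_rw [hk]
  exact hasSum_ite_eq n _

lemma partitionNumber_eq_scaled_integral {t : ℝ} (ht : 0 < t) (n : ℕ) :
    (partitionNumber n : ℂ) * (2 * Real.pi) =
      t * ∫ u in (-(Real.pi / t))..(Real.pi / t), 
        partitionGen (Complex.exp (-(t * (1 + u * Complex.I)))) *
          Complex.exp (n * (t * (1 + u * Complex.I))) := by
  rw [partitionNumber_eq_integral ht]
  have := intervalIntegral.smul_integral_comp_mul_left (a := -(Real.pi / t)) (b := Real.pi / t)
    (fun θ : ℝ ↦ partitionGen (Complex.exp (-(t + θ * Complex.I))) *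
        Complex.exp (n * (t + θ * Complex.I))) t
  rw [mul_neg, mul_div_cancel₀ _ ht.ne'] at this
  rw [← this, Complex.real_smul]
  congr 2
  ext u
  push_cast
  ring_nf

/-! ### Decay away from x = 1 -/

lemma exp_half_le_one_add_two_mul {d : ℝ} (h0 : 0 ≤ d) (h2 : d ≤ 2) :
    Real.exp (d / 2) ≤ 1 + 2 * d := by
  have := (abs_le.mp (Real.abs_exp_sub_one_sub_id_le (x := d / 2)
    (by rw [abs_of_nonneg (by linarith)]; linarith))).2
  nlinarith

lemma norm_one_sub_sq (y : ℂ) :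
    ‖1 - y‖ ^ 2 = (1 - ‖y‖) ^ 2 + 2 * (‖y‖ - y.re) := by
  have h : ‖y‖ ^ 2 = y.re ^ 2 + y.im ^ 2 := by
    rw [Complex.sq_norm, Complex.normSq_apply]; ring
  rw [Complex.sq_norm, Complex.normSq_apply]
  simp only [Complex.sub_re, Complex.sub_im, Complex.one_re, Complex.one_im]
  linear_combination -h

/-- Put d = |y| - Re y, which lies in [0, 2]. Then |1-y|² = (1-|y|)² + 2d, and since (1-|y|)² ≤ 1
this additive gain is at least the multiplicative one (1-|y|)²(1+2d), with 1+2d ≥ e^(d/2). -/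
lemma one_sub_norm_mul_exp_le {y : ℂ} (hy : ‖y‖ < 1) :
    (1 - ‖y‖) * Real.exp ((‖y‖ - y.re) / 4) ≤ ‖1 - y‖ := by
  have h1 := Complex.re_le_norm y
  have h2 := (abs_le.mp (Complex.abs_re_le_norm y)).1
  have h3 := exp_half_le_one_add_two_mul (d := ‖y‖ - y.re) (by linarith) (by linarith)
  refine le_of_sq_le_sq ?_ (norm_nonneg _)
  rw [norm_one_sub_sq, mul_pow, ← Real.exp_nat_mul,
    show ((2 : ℕ) : ℝ) * ((‖y‖ - y.re) / 4) = (‖y‖ - y.re) / 2 by push_cast; ring]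
  have h4 : (1 - ‖y‖) ^ 2 ≤ 1 := by nlinarith [norm_nonneg y]
  nlinarith [sq_nonneg (1 - ‖y‖)]

/-- Apply `one_sub_norm_mul_exp_le` to each factor y = x^m of Euler's product. The exponents sum to
a difference of two geometric series, whose m = 0 terms cancel. -/
lemma norm_partitionGen_le {x : ℂ} (hx : ‖x‖ < 1) :
    ‖partitionGen x‖ ≤ ‖partitionGen (‖x‖ : ℂ)‖ *
      Real.exp (-((1 - ‖x‖)⁻¹ - ((1 - x)⁻¹).re) / 4) := by
  have hr : ‖(‖x‖ : ℂ)‖ < 1 := by simpa using hx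
  have hs : HasSum (fun m : ℕ ↦ ‖x‖ ^ (m + 1) - (x ^ (m + 1)).re)
      ((1 - ‖x‖)⁻¹ - ((1 - x)⁻¹).re) := by
    have h1 := (hasSum_geometric_of_lt_one (norm_nonneg x) hx).sub
      (Complex.hasSum_re (hasSum_geometric_of_norm_lt_one hx))
    simpa using (hasSum_nat_add_iff' 1).mpr h1
  have h1 : ‖eulerProduct (‖x‖ : ℂ)‖ * Real.exp (((1 - ‖x‖)⁻¹ - ((1 - x)⁻¹).re) / 4) ≤
      ‖eulerProduct x‖ := by
    have l1 := (tendsto_prod_eulerProduct hr).norm.mul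
      ((Real.continuous_exp.tendsto _).comp (hs.tendsto_sum_nat.div_const 4))
    refine le_of_tendsto_of_tendsto' l1 (tendsto_prod_eulerProduct hx).norm fun N ↦ ?_
    simp only [Function.comp_apply, norm_prod, Finset.sum_div, Real.exp_sum]
    rw [← Finset.prod_mul_distrib]
    refine Finset.prod_le_prod (fun _ _ ↦ by positivity) fun m _ ↦ ?_
    have hm : ‖x ^ (m + 1)‖ < 1 := by
      rw [norm_pow]; exact pow_lt_one₀ (norm_nonneg _) hx (by omega)
    have := one_sub_norm_mul_exp_le hm
    rw [norm_pow] at this hm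
    refine le_trans (le_of_eq ?_) this
    congr 1
    rw [show (1 : ℂ) - (‖x‖ : ℂ) ^ (m + 1) = ((1 - ‖x‖ ^ (m + 1) : ℝ) : ℂ) by push_cast; rfl,
      Complex.norm_real, Real.norm_of_nonneg (by linarith)]
  rw [partitionGen_eq_inv hx, partitionGen_eq_inv hr, norm_inv, norm_inv, neg_div, Real.exp_neg,
    ← mul_inv]
  gcongr
  have := norm_pos_iff.mpr (eulerProduct_ne_zero hr)
  positivity

lemma norm_partitionGen_minor_arc_le {t u : ℝ} (ht : 0 < t) (ht2 : t ≤ 3 / 2) (hu : 1 ≤ |u|)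
    (hu2 : |u| ≤ Real.pi / t) :
    ‖partitionGen (Complex.exp (-(t * (1 + u * Complex.I))))‖ ≤
      ‖partitionGen (Complex.exp (-t))‖ * Real.exp (-(1 / (200 * t))) := by
  set x := Complex.exp (-(t * (1 + u * Complex.I))) with hxdef
  set r := Real.exp (-t) with hrdef
  have hxr : ‖x‖ = r := by simp [hxdef, hrdef, Complex.norm_exp]
  have hr1 : r < 1 := by rw [hrdef, ← Real.exp_zero]; exact Real.exp_lt_exp.mpr (by linarith)
  have hrt : 1 - r ≤ t := by linarith [Real.add_one_le_exp (-t)]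
  -- With r ≥ 1/5 and 1 - cos(tu) ≥ t²/5, the excess 2r(1 - cos(tu)) is at least 0.08 t² ≥ 0.08
  -- (1-r)², and 1.03² < 1.08. The resulting saving in the exponent is (3/103)/(4t) ≥ 1/(200t).
  have hr5 : 1 / 5 ≤ r := by
    have h1 : Real.exp (3 / 2) ≤ 5 := by
      have h2 : Real.exp (3 / 2) ^ 2 ≤ 5 ^ 2 := by
        rw [← Real.exp_nat_mul, show ((2 : ℕ) : ℝ) * (3 / 2) = ((3 : ℕ) : ℝ) * 1 by norm_num,
          Real.exp_nat_mul]
        have := Real.exp_one_lt_d9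
        calc Real.exp 1 ^ 3 ≤ 2.7182818286 ^ 3 := by gcongr
          _ ≤ _ := by norm_num
      exact le_of_sq_le_sq h2 (by norm_num)
    rw [hrdef, Real.exp_neg, one_div]
    refine inv_anti₀ (Real.exp_pos _) ((Real.exp_le_exp.mpr ht2).trans h1)
  have hre : x.re = r * Real.cos (t * u) := by
    simp [hxdef, hrdef, Complex.exp_re]
  have htu : |t * u| ≤ Real.pi := by
    rw [abs_mul, abs_of_pos ht]
    rwa [le_div_iff₀ ht, mul_comm] at hu2
  have hcos := Real.cos_le_one_sub_mul_cos_sq htu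
  have hpi2 : Real.pi ^ 2 ≤ 10 := by nlinarith [Real.pi_lt_d2, Real.pi_pos]
  have hu3 : 1 ≤ u ^ 2 := by rw [← sq_abs]; nlinarith
  have hcos2 : t ^ 2 / 5 ≤ 1 - Real.cos (t * u) := by
    have h1 : (1 : ℝ) / 5 ≤ 2 / Real.pi ^ 2 := by
      rw [div_le_div_iff₀ (by norm_num) (by positivity)]; linarith
    have h2 : t ^ 2 ≤ (t * u) ^ 2 := by rw [mul_pow]; nlinarith [sq_nonneg t]
    nlinarith [sq_nonneg t]
  have hsq : ((1 - r) * (103 / 100)) ^ 2 ≤ ‖1 - x‖ ^ 2 := by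
    rw [norm_one_sub_sq, hxr, hre]
    have h1 : (1 - r) ^ 2 ≤ t ^ 2 := by nlinarith
    nlinarith [sq_nonneg t]
  have hge : (1 - r) * (103 / 100) ≤ ‖1 - x‖ := le_of_sq_le_sq hsq (norm_nonneg _)
  have hinv : ((1 - x)⁻¹).re ≤ (1 - r)⁻¹ * (100 / 103) := by
    refine (Complex.re_le_norm _).trans ?_
    rw [norm_inv]
    refine (inv_anti₀ (by nlinarith) hge).trans (le_of_eq ?_)
    rw [mul_inv]; norm_num
  have hti : t⁻¹ ≤ (1 - r)⁻¹ := inv_anti₀ (by linarith) hrt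
  refine (norm_partitionGen_le (by rw [hxr]; exact hr1)).trans ?_
  rw [hxr, hrdef]
  push_cast
  gcongr
  have : 1 / (200 * t) = t⁻¹ / 200 := by field_simp
  rw [this]
  have : 0 < t⁻¹ := by positivity
  linarith

/-! ### Gaussian approximation near x = 1 -/

lemma Complex.sqrt_ofReal_mul {c : ℝ} (hc : 0 < c) {w : ℂ} (hw : w ≠ 0) :
    ((c : ℂ) * w).sqrt = (√c : ℝ) * w.sqrt := by
  rw [sqrt_eq_exp (mul_ne_zero (by exact_mod_cast hc.ne') hw), sqrt_eq_exp hw,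
    Complex.log_ofReal_mul hc hw, add_div, Complex.exp_add]
  congr 1
  rw [show (Real.log c : ℂ) / 2 = ((Real.log c / 2 : ℝ) : ℂ) by push_cast; rfl,
    ← Complex.ofReal_exp, Real.exp_half, Real.exp_log hc]

lemma Complex.sqrt_sq_of_ne_zero {w : ℂ} (hw : w ≠ 0) : w.sqrt ^ 2 = w := by
  rw [sqrt_eq_exp hw, ← Complex.exp_nat_mul]
  push_cast
  rw [mul_div_cancel₀ _ two_ne_zero, Complex.exp_log hw]

lemma Complex.re_sqrt_nonneg (w : ℂ) : 0 ≤ w.sqrt.re := by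
  rw [Complex.sqrt_eq_real_add_ite]
  split_ifs <;> simp <;> positivity

/-- From w - 1 = (√w - 1)(√w + 1), where |√w + 1| ≥ 1 because Re √w ≥ 0. -/
lemma Complex.norm_sqrt_sub_one_le {w : ℂ} (hw : w ≠ 0) : ‖w.sqrt - 1‖ ≤ ‖w - 1‖ := by
  have h1 : w - 1 = (w.sqrt - 1) * (w.sqrt + 1) := by
    linear_combination -(Complex.sqrt_sq_of_ne_zero hw)
  have h2 : 1 ≤ ‖w.sqrt + 1‖ := by
    refine le_trans ?_ (Complex.re_le_norm _)
    simpa using Complex.re_sqrt_nonneg w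
  rw [h1, norm_mul]
  exact le_mul_of_one_le_right (norm_nonneg _) h2

lemma norm_exp_sub_exp_le {A B : ℂ} {m : ℝ} (hA : A.re ≤ m) (hB : B.re ≤ m) :
    ‖Complex.exp A - Complex.exp B‖ ≤ Real.exp m * ‖A - B‖ := by
  refine Convex.norm_image_sub_le_of_norm_deriv_le (f := Complex.exp) (s := {z | z.re ≤ m})
    (fun z _ ↦ Complex.differentiable_exp z) (fun z hz ↦ ?_) (convex_halfSpace_re_le m) hB hA
  rw [Complex.deriv_exp, Complex.norm_exp]
  exact Real.exp_le_exp.mpr hz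

lemma one_add_mul_I_ne_zero (u : ℝ) : (1 + u * Complex.I : ℂ) ≠ 0 := by
  intro h
  simpa using congrArg Complex.re h

/-- Split the exponent as 1/2 = 3/8 + 1/8: the first part absorbs √L|u|, and the second is left as a
Gaussian to integrate. -/
lemma abs_mul_exp_le {L : ℝ} (hL : 0 < L) (u : ℝ) :
    |u| * Real.exp (-(L * u ^ 2 / 2)) ≤ 3 * (√L)⁻¹ * Real.exp (-(L / 8) * u ^ 2) := by
  have h0 : Real.exp (-(L * u ^ 2 / 2)) =
      Real.exp (-(3 / 8 * (L * u ^ 2))) * Real.exp (-(L / 8) * u ^ 2) := by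
    rw [← Real.exp_add]; ring_nf
  have h1 : √L * |u| ≤ 3 * Real.exp (3 / 8 * (L * u ^ 2)) := by
    have h2 : (√L * |u|) ^ 2 = L * u ^ 2 := by rw [mul_pow, Real.sq_sqrt hL.le, sq_abs]
    have := Real.add_one_le_exp (3 / 8 * (L * u ^ 2))
    nlinarith [sq_nonneg (√L * |u| - 1)]
  have hs := Real.sqrt_pos.mpr hL
  rw [h0, ← mul_assoc]
  refine mul_le_mul_of_nonneg_right ?_ (Real.exp_pos _).le
  rw [Real.exp_neg, ← div_eq_mul_inv, ← div_eq_mul_inv, div_le_div_iff₀ (Real.exp_pos _) hs]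
  linarith

lemma mul_abs_pow_three_mul_exp_le {L : ℝ} (hL : 0 < L) (u : ℝ) :
    L * |u| ^ 3 * Real.exp (-(L * u ^ 2 / 2)) ≤
      18 * (√L)⁻¹ * Real.exp (-(L / 8) * u ^ 2) := by
  have h0 : Real.exp (-(L * u ^ 2 / 2)) =
      Real.exp (-(3 / 8 * (L * u ^ 2))) * Real.exp (-(L / 8) * u ^ 2) := by
    rw [← Real.exp_add]; ring_nf
  have hs := Real.sqrt_pos.mpr hL
  have h1 : L * |u| ^ 3 * √L ≤ 18 * Real.exp (3 / 8 * (L * u ^ 2)) := by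
    have h2 : (√L * |u|) ^ 2 = L * u ^ 2 := by rw [mul_pow, Real.sq_sqrt hL.le, sq_abs]
    have h3 : L * |u| ^ 3 * √L = (√L * |u|) ^ 3 := by
      rw [mul_pow, show √L ^ 3 = √L ^ 2 * √L by ring, Real.sq_sqrt hL.le]; ring
    rw [h3, ← h2]
    have h4 : 0 ≤ √L * |u| := by positivity
    have h5 := Real.quadratic_le_exp_of_nonneg (x := 3 / 8 * (√L * |u|) ^ 2) (by positivity)
    generalize √L * |u| = v at *
    nlinarith [sq_nonneg (v ^ 2 - v), sq_nonneg v, sq_nonneg (v ^ 2)]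
  rw [h0, ← mul_assoc]
  refine mul_le_mul_of_nonneg_right ?_ (Real.exp_pos _).le
  rw [Real.exp_neg, ← div_eq_mul_inv, ← div_eq_mul_inv, div_le_div_iff₀ (Real.exp_pos _) hs]
  linarith

lemma exp_neg_le_inv_sqrt {L : ℝ} (hL : 1 ≤ L) : Real.exp (-(12 * L)) ≤ (√L)⁻¹ := by
  rw [Real.exp_neg]
  refine inv_anti₀ (by positivity) ?_
  have := Real.add_one_le_exp (12 * L)
  nlinarith [Real.sq_sqrt (show 0 ≤ L by linarith), Real.sqrt_nonneg L]

/-- The integrand for `p_n` after rescaling the circle of radius `exp (-t)`. -/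
noncomputable def partitionIntegrand (n : ℕ) (t u : ℝ) : ℂ :=
  partitionGen (Complex.exp (-(t * (1 + u * Complex.I)))) *
    Complex.exp (n * (t * (1 + u * Complex.I)))

lemma continuous_partitionIntegrand (n : ℕ) {t : ℝ} (ht : 0 < t) :
    Continuous (partitionIntegrand n t) := by
  have hr : Real.exp (-t) < 1 := Real.exp_zero ▸ Real.exp_lt_exp.mpr (by linarith)
  have : Continuous fun u : ℝ ↦ partitionGen (Complex.exp (-(t * (1 + u * Complex.I)))) := by
    refine continuous_tsum (u := fun k ↦ (partitionNumber k : ℝ) * Real.exp (-t) ^ k)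
      (fun k ↦ by fun_prop) (summable_partitionNumber_real (Real.exp_pos _).le hr) fun k u ↦ ?_
    simp [Complex.norm_exp]
  exact this.mul (by fun_prop)

/-- The hypotheses express the saddle-point choice: π²/(6t) and (n - 1/24)t both equal L. The
exponent is then L/(1+iu) + L(1+iu) = 2L - Lu²/(1+iu). -/
lemma partitionIntegrand_eq {n : ℕ} {t L : ℝ} (ht : 0 < t) (htL : t * L = Real.pi ^ 2 / 6)
    (hn : ((n : ℝ) - 1 / 24) * t = L) (u : ℝ) :
    partitionIntegrand n t u = (√(t / (2 * Real.pi)) * Real.exp (2 * L) : ℝ) *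
      ((1 + u * Complex.I).sqrt * Complex.exp (-(L * u ^ 2) / (1 + u * Complex.I)) *
        partitionGen (Complex.exp (-((4 * Real.pi ^ 2 : ℝ) / (t * (1 + u * Complex.I)))))) := by
  have hu := one_add_mul_I_ne_zero u
  have ht0 : (t : ℂ) ≠ 0 := by exact_mod_cast ht.ne'
  have hpi : (Real.pi : ℂ) ≠ 0 := Complex.ofReal_ne_zero.mpr Real.pi_ne_zero
  have hre : 0 < ((t : ℂ) * (1 + u * Complex.I)).re := by simpa using ht
  rw [partitionIntegrand, partitionGen_transform hre,
    show (t : ℂ) * (1 + u * Complex.I) / (2 * Real.pi) =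
      ((t / (2 * Real.pi) : ℝ) : ℂ) * (1 + u * Complex.I) by push_cast; ring,
    Complex.sqrt_ofReal_mul (by positivity) hu, Complex.ofReal_mul (√_), Complex.ofReal_exp]
  have hexp : ((Real.pi ^ 2 / 6 : ℝ) : ℂ) / (t * (1 + u * Complex.I)) -
      t * (1 + u * Complex.I) / 24 + n * (t * (1 + u * Complex.I)) =
      ((2 * L : ℝ) : ℂ) + -(L * u ^ 2) / (1 + u * Complex.I) := by
    have h2 : ((n : ℂ) - 1 / 24) * t = L := by
      rw [← hn]; push_cast; ring
    have h3 : ((n : ℂ) * (t * (1 + u * Complex.I))) - t * (1 + u * Complex.I) / 24 =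
        L * (1 + u * Complex.I) := by rw [← h2]; ring
    rw [← htL, sub_add_eq_add_sub, add_sub_assoc, h3]
    push_cast
    field_simp
    linear_combination (L : ℂ) * u ^ 2 * Complex.I_sq
  have := congrArg Complex.exp hexp
  rw [Complex.exp_add, Complex.exp_add] at this
  linear_combination (√(t / (2 * Real.pi)) : ℝ) * (1 + u * Complex.I).sqrt *
    partitionGen (Complex.exp (-((4 * Real.pi ^ 2 : ℝ) / (t * (1 + u * Complex.I))))) * this

lemma re_div_one_add_mul_I (c u : ℝ) :
    ((c : ℂ) / (1 + u * Complex.I)).re = c / (1 + u ^ 2) := by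
  rw [div_eq_mul_inv, Complex.re_ofReal_mul, Complex.inv_re, Complex.normSq_apply]
  simp
  ring

lemma exists_norm_major_arc_le : ∃ K : ℝ, 3 ≤ K ∧ ∀ (n : ℕ) (t L : ℝ), 0 < t → 1 ≤ L →
    t * L = Real.pi ^ 2 / 6 → ((n : ℝ) - 1 / 24) * t = L → ∀ u : ℝ, |u| ≤ 1 →
      ‖partitionIntegrand n t u / (√(t / (2 * Real.pi)) * Real.exp (2 * L) : ℝ) -
        (Real.exp (-L * u ^ 2) : ℝ)‖ ≤ K * (√L)⁻¹ * Real.exp (-(L / 8) * u ^ 2) := by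
  obtain ⟨M, hM0, hM⟩ := exists_norm_partitionGen_sub_one_le
  -- Three errors are added: 2M from replacing the transformed generating function by 1, 3 from
  -- √(1+iu) ≈ 1, and 18 from replacing Lu²/(1+iu) by Lu² in the exponent.
  refine ⟨2 * M + 21, by linarith, fun n t L ht hL htL hn u hu ↦ ?_⟩
  have hL0 : 0 < L := by linarith
  have hsL : 0 < √L := Real.sqrt_pos.mpr hL0
  have hw0 := one_add_mul_I_ne_zero u
  have hu2 : u ^ 2 ≤ 1 := by rw [← sq_abs]; nlinarith [abs_nonneg u]
  have hB : ((√(t / (2 * Real.pi)) * Real.exp (2 * L) : ℝ) : ℂ) ≠ 0 := by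
    rw [Complex.ofReal_ne_zero]
    have : 0 < √(t / (2 * Real.pi)) := Real.sqrt_pos.mpr (by positivity)
    positivity
  rw [partitionIntegrand_eq ht htL hn, mul_div_cancel_left₀ _ hB]
  set w := (1 + u * Complex.I).sqrt with hw
  set Z := -((L : ℂ) * u ^ 2) / (1 + u * Complex.I) with hZ
  set q := Complex.exp (-((4 * Real.pi ^ 2 : ℝ) / (t * (1 + u * Complex.I)))) with hq
  have hw1 : ‖w - 1‖ ≤ |u| := by
    refine (Complex.norm_sqrt_sub_one_le hw0).trans (le_of_eq ?_)
    simp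
  have hw2 : ‖w‖ ≤ 2 := by
    calc ‖w‖ = ‖(w - 1) + 1‖ := by ring_nf
      _ ≤ ‖w - 1‖ + ‖(1 : ℂ)‖ := norm_add_le _ _
      _ ≤ 2 := by rw [norm_one]; linarith
  have hZre : Z.re ≤ -(L * u ^ 2 / 2) := by
    have : Z = ((-(L * u ^ 2) : ℝ) : ℂ) / (1 + u * Complex.I) := by rw [hZ]; push_cast; rfl
    rw [this, re_div_one_add_mul_I, neg_div, neg_le_neg_iff]
    gcongr
    linarith
  have hZn : ‖Complex.exp Z‖ ≤ Real.exp (-(L * u ^ 2 / 2)) := by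
    rw [Complex.norm_exp]; exact Real.exp_le_exp.mpr hZre
  have hqn : ‖q‖ ≤ Real.exp (-(12 * L)) := by
    rw [hq, Complex.norm_exp]
    refine Real.exp_le_exp.mpr ?_
    -- By the saddle relation 4π²/t = 24L, and dividing by 1 + u² ≤ 2 leaves at least 12L.
    have : ((4 * Real.pi ^ 2 : ℝ) : ℂ) / (t * (1 + u * Complex.I)) =
        ((24 * L : ℝ) : ℂ) / (1 + u * Complex.I) := by
      have ht0 : (t : ℂ) ≠ 0 := by exact_mod_cast ht.ne'
      have h2 : (t : ℂ) * L = Real.pi ^ 2 / 6 := by exact_mod_cast htL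
      push_cast
      field_simp
      linear_combination -24 * h2
    rw [this, Complex.neg_re, re_div_one_add_mul_I, neg_le_neg_iff, le_div_iff₀ (by positivity)]
    nlinarith
  have hqs : ‖q‖ ≤ (√L)⁻¹ := hqn.trans (exp_neg_le_inv_sqrt hL)
  have hqh : ‖q‖ ≤ 1 / 2 := by
    refine hqn.trans ?_
    rw [Real.exp_neg, one_div]
    exact inv_anti₀ two_pos (by linarith [Real.add_one_le_exp (12 * L)])
  have hP : ‖partitionGen q - 1‖ ≤ M * (√L)⁻¹ := (hM q hqh).trans (by gcongr)
  have hexp : ‖Complex.exp Z - (Real.exp (-L * u ^ 2) : ℝ)‖ ≤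
      Real.exp (-(L * u ^ 2 / 2)) * (L * |u| ^ 3) := by
    rw [Complex.ofReal_exp]
    refine (norm_exp_sub_exp_le hZre (B := ((-L * u ^ 2 : ℝ) : ℂ)) ?_).trans ?_
    · rw [Complex.ofReal_re]; nlinarith [sq_nonneg u]
    · gcongr
      have : Z - ((-L * u ^ 2 : ℝ) : ℂ) = (L * u ^ 3 : ℝ) * Complex.I / (1 + u * Complex.I) := by
        rw [hZ]
        push_cast
        field_simp
        ring
      have hden : 1 ≤ ‖(1 : ℂ) + u * Complex.I‖ := by
        refine le_trans ?_ (Complex.re_le_norm _)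
        simp
      rw [this, norm_div, norm_mul, Complex.norm_I, mul_one, Complex.norm_real, Real.norm_eq_abs,
        abs_mul, abs_pow, abs_of_pos hL0]
      exact div_le_self (by positivity) hden
  have e1 := abs_mul_exp_le hL0 u
  have e2 := mul_abs_pow_three_mul_exp_le hL0 u
  have e3 : Real.exp (-(L * u ^ 2 / 2)) ≤ Real.exp (-(L / 8) * u ^ 2) :=
    Real.exp_le_exp.mpr (by nlinarith [sq_nonneg u])
  have hsplit : w * Complex.exp Z * partitionGen q - (Real.exp (-L * u ^ 2) : ℝ) =
      w * Complex.exp Z * (partitionGen q - 1) + (w - 1) * Complex.exp Z +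
        (Complex.exp Z - (Real.exp (-L * u ^ 2) : ℝ)) := by ring
  rw [hsplit]
  calc _ ≤ ‖w * Complex.exp Z * (partitionGen q - 1)‖ + ‖(w - 1) * Complex.exp Z‖ +
        ‖Complex.exp Z - (Real.exp (-L * u ^ 2) : ℝ)‖ := norm_add₃_le
    _ ≤ 2 * Real.exp (-(L / 8) * u ^ 2) * (M * (√L)⁻¹) + |u| * Real.exp (-(L * u ^ 2 / 2)) +
        Real.exp (-(L * u ^ 2 / 2)) * (L * |u| ^ 3) := by
      rw [norm_mul, norm_mul, norm_mul]
      gcongr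
      exact hZn.trans e3
    _ ≤ _ := by linarith

/-! ### Evaluation of the Cauchy integral -/

lemma mul_exp_neg_le {y : ℝ} (hy : 0 < y) : y * Real.exp (-(y / 200)) ≤ 80000 / y := by
  have h := Real.quadratic_le_exp_of_nonneg (x := y / 200) (by positivity)
  rw [Real.exp_neg, ← div_eq_mul_inv, div_le_div_iff₀ (Real.exp_pos _) hy]
  nlinarith

/-- Extend the normalised integrand by zero to the real line and compare it pointwise with
exp(-Lu²). The Gaussian part of the majorant has mass O(L^(-1/2)·L^(-1/2)); the minor-arc part is
exponentially small in 1/t, which is proportional to L. The main term being √(π/L), the relative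
error is O(L^(-1/2)). -/
lemma exists_norm_integral_sub_le : ∃ K : ℝ, 0 < K ∧ ∀ (n : ℕ) (t L : ℝ), 0 < t → t ≤ 3 / 2 →
    1 ≤ L → t * L = Real.pi ^ 2 / 6 → ((n : ℝ) - 1 / 24) * t = L →
      ‖(∫ u in (-(Real.pi / t))..(Real.pi / t), partitionIntegrand n t u) /
        (√(t / (2 * Real.pi)) * Real.exp (2 * L) : ℝ) - (√(Real.pi / L) : ℝ)‖ ≤ K / L := by
  obtain ⟨K, hK3, hK⟩ := exists_norm_major_arc_le
  refine ⟨K * √(8 * Real.pi) + (1 + K) * (2 * Real.pi * (80000 * (Real.pi ^ 2 / 6))), by positivity,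
    fun n t L ht ht2 hL htL hn ↦ ?_⟩
  have hL0 : 0 < L := by linarith
  have hsL : 0 < √L := Real.sqrt_pos.mpr hL0
  set B : ℝ := √(t / (2 * Real.pi)) * Real.exp (2 * L) with hBdef
  have hB : 0 < B := by
    have : 0 < √(t / (2 * Real.pi)) := Real.sqrt_pos.mpr (by positivity)
    positivity
  set T : ℝ := Real.pi / t with hT
  -- Ensures that points outside the integration range satisfy |u| ≥ 1, where the Gaussian is
  -- negligible.
  have hT1 : 1 ≤ T := by
    rw [hT, le_div_iff₀ ht]; linarith [Real.pi_gt_three]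
  set S : Set ℝ := Set.Ioc (-T) T with hS
  set g : ℝ → ℂ := S.indicator fun u ↦ partitionIntegrand n t u / (B : ℂ) with hg
  set D : ℝ := (1 + K) * Real.exp (-(1 / (200 * t))) with hD
  have hD0 : 0 ≤ D := by positivity
  have hcont := continuous_partitionIntegrand n ht
  have hgint : Integrable g := by
    rw [hg, integrable_indicator_iff measurableSet_Ioc]
    exact ((hcont.div_const _).integrableOn_Icc (a := -T) (b := T)).mono_set Set.Ioc_subset_Icc_self
  have hgauss : Integrable fun u : ℝ ↦ ((Real.exp (-L * u ^ 2) : ℝ) : ℂ) :=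
    (integrable_exp_neg_mul_sq hL0).ofReal
  -- The minor-arc bound is relative to the value at u = 0, which the major-arc estimate controls.
  have hzero : ‖partitionIntegrand n t 0‖ ≤ B * (1 + K) := by
    have h := hK n t L ht hL htL hn 0 (by simp)
    rw [← hBdef] at h
    simp only [ne_eq, OfNat.ofNat_ne_zero, not_false_eq_true, zero_pow, mul_zero, Real.exp_zero,
      mul_one, Complex.ofReal_one] at h
    have hs1 : (√L)⁻¹ ≤ 1 := inv_le_one_of_one_le₀ (Real.one_le_sqrt.mpr hL)
    have h2 : ‖partitionIntegrand n t 0 / (B : ℂ)‖ ≤ 1 + K := by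
      calc _ = ‖1 + (partitionIntegrand n t 0 / (B : ℂ) - 1)‖ := by ring_nf
        _ ≤ ‖(1 : ℂ)‖ + ‖partitionIntegrand n t 0 / (B : ℂ) - 1‖ := norm_add_le _ _
        _ ≤ 1 + K := by rw [norm_one]; nlinarith
    rwa [norm_div, Complex.norm_real, Real.norm_of_nonneg hB.le, div_le_iff₀ hB, mul_comm] at h2
  have hminor : ∀ u : ℝ, 1 ≤ |u| → |u| ≤ T → ‖partitionIntegrand n t u / (B : ℂ)‖ ≤ D := by
    intro u hu1 hu2
    have h1 := norm_partitionGen_minor_arc_le ht ht2 hu1 hu2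
    have h2 : ‖partitionIntegrand n t u‖ ≤
        ‖partitionIntegrand n t 0‖ * Real.exp (-(1 / (200 * t))) := by
      unfold partitionIntegrand
      rw [norm_mul, norm_mul, mul_right_comm]
      refine mul_le_mul ?_ (le_of_eq ?_) (norm_nonneg _) (by positivity)
      · simpa using h1
      · simp [Complex.norm_exp]
    rw [norm_div, Complex.norm_real, Real.norm_of_nonneg hB.le, div_le_iff₀ hB, hD]
    calc _ ≤ _ := h2
      _ ≤ B * (1 + K) * Real.exp (-(1 / (200 * t))) := by gcongr
      _ = _ := by ring
  have htail : ∀ u : ℝ, 1 ≤ |u| → ‖((Real.exp (-L * u ^ 2) : ℝ) : ℂ)‖ ≤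
      K * (√L)⁻¹ * Real.exp (-(L / 8) * u ^ 2) := by
    intro u hu
    rw [Complex.norm_real, Real.norm_of_nonneg (Real.exp_pos _).le]
    calc Real.exp (-L * u ^ 2) ≤ 1 * Real.exp (-(L * u ^ 2 / 2)) := by
          rw [one_mul]; exact Real.exp_le_exp.mpr (by nlinarith [sq_nonneg u])
      _ ≤ |u| * Real.exp (-(L * u ^ 2 / 2)) := by gcongr
      _ ≤ 3 * (√L)⁻¹ * Real.exp (-(L / 8) * u ^ 2) := abs_mul_exp_le hL0 u
      -- This is where K ≥ 3 is needed.
      _ ≤ _ := by gcongr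
  have hpt : ∀ u : ℝ, ‖g u - (Real.exp (-L * u ^ 2) : ℝ)‖ ≤
      K * (√L)⁻¹ * Real.exp (-(L / 8) * u ^ 2) + S.indicator (fun _ ↦ D) u := by
    intro u
    by_cases hu : u ∈ S
    · rw [hg, Set.indicator_of_mem hu, Set.indicator_of_mem hu]
      rcases le_total |u| 1 with h1 | h1
      · exact (hK n t L ht hL htL hn u h1).trans (by linarith)
      · have h2 : |u| ≤ T := abs_le.mpr ⟨hu.1.le, hu.2⟩
        refine (norm_sub_le _ _).trans ?_
        linarith [hminor u h1 h2, htail u h1]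
    · rw [hg, Set.indicator_of_notMem hu, Set.indicator_of_notMem hu, zero_sub, norm_neg, add_zero]
      refine htail u ?_
      by_contra! h
      exact hu ⟨by linarith [(abs_lt.mp h).1], by linarith [(abs_lt.mp h).2]⟩
  have hL8 : 0 < L / 8 := by positivity
  have hbint1 : Integrable fun u : ℝ ↦ K * (√L)⁻¹ * Real.exp (-(L / 8) * u ^ 2) :=
    (integrable_exp_neg_mul_sq hL8).const_mul _
  have hbint2 : Integrable (S.indicator fun _ : ℝ ↦ D) := by
    rw [integrable_indicator_iff measurableSet_Ioc]
    exact integrableOn_const (by simp)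
  have hmain := norm_integral_le_of_norm_le (hbint1.add hbint2) (Eventually.of_forall hpt)
  have e1 : ∫ u, (g u - (Real.exp (-L * u ^ 2) : ℝ)) =
      (∫ u in (-T)..T, partitionIntegrand n t u) / (B : ℂ) - (√(Real.pi / L) : ℝ) := by
    rw [integral_sub hgint hgauss, integral_complex_ofReal, integral_gaussian, hg,
      integral_indicator measurableSet_Ioc, intervalIntegral.integral_of_le (by linarith),
      integral_div]
  have e2 : ∫ u, ((fun u : ℝ ↦ K * (√L)⁻¹ * Real.exp (-(L / 8) * u ^ 2)) +
      S.indicator fun _ : ℝ ↦ D) u = K * (√L)⁻¹ * √(Real.pi / (L / 8)) + 2 * T * D := by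
    rw [integral_add' hbint1 hbint2, integral_const_mul, integral_gaussian,
      integral_indicator measurableSet_Ioc, setIntegral_const, Measure.real, Real.volume_Ioc,
      ENNReal.toReal_ofReal (by linarith), smul_eq_mul]
    ring
  rw [e1] at hmain
  refine hmain.trans (e2.le.trans ?_)
  have e3 : K * (√L)⁻¹ * √(Real.pi / (L / 8)) = K * √(8 * Real.pi) / L := by
    rw [show Real.pi / (L / 8) = 8 * Real.pi / L by field_simp, Real.sqrt_div (by positivity)]
    field_simp
    rw [Real.sq_sqrt hL0.le]
  have e4 : T * Real.exp (-(1 / (200 * t))) ≤ Real.pi * (80000 * (Real.pi ^ 2 / 6)) / L := by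
    have h := mul_exp_neg_le (y := 1 / t) (by positivity)
    rw [show 1 / t / 200 = 1 / (200 * t) by field_simp] at h
    have h2 : t = Real.pi ^ 2 / 6 / L := by rw [← htL]; field_simp
    calc T * Real.exp (-(1 / (200 * t))) = Real.pi * (1 / t * Real.exp (-(1 / (200 * t)))) := by
          rw [hT]; ring
      _ ≤ Real.pi * (80000 / (1 / t)) := by gcongr
      _ = Real.pi * (80000 * t) := by field_simp
      _ = Real.pi * (80000 * (Real.pi ^ 2 / 6 / L)) := by rw [← h2]
      _ = _ := by ring
  rw [e3, add_div, add_le_add_iff_left, hD]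
  calc 2 * T * ((1 + K) * Real.exp (-(1 / (200 * t))))
      = 2 * (1 + K) * (T * Real.exp (-(1 / (200 * t)))) := by ring
    _ ≤ 2 * (1 + K) * (Real.pi * (80000 * (Real.pi ^ 2 / 6)) / L) := by gcongr
    _ = _ := by ring

/-! ### Hardy–Ramanujan asymptotics with relative error -/

lemma hrLambda_sq {n : ℕ} (hn : 1 ≤ n) : hrLambda n ^ 2 = n - 1 / 24 := by
  have : (1 : ℝ) ≤ n := by exact_mod_cast hn
  exact Real.sq_sqrt (by linarith)

lemma le_hrLambda {n : ℕ} (hn : 1 ≤ n) : 97 / 100 ≤ hrLambda n := by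
  have : (1 : ℝ) ≤ n := by exact_mod_cast hn
  exact Real.le_sqrt_of_sq_le (by linarith)

lemma hrConst_sq : hrConst ^ 2 = 2 * Real.pi ^ 2 / 3 := by
  rw [hrConst, mul_pow, Real.sq_sqrt (by norm_num)]
  ring

lemma hrConst_nonneg : 0 ≤ hrConst := by
  unfold hrConst
  positivity

lemma le_hrConst : 5 / 2 ≤ hrConst := by
  refine le_of_sq_le_sq ?_ hrConst_nonneg
  rw [hrConst_sq]
  nlinarith [Real.pi_gt_d2]

lemma hrConst_le : hrConst ≤ 13 / 5 := by
  refine le_of_sq_le_sq ?_ (by norm_num)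
  rw [hrConst_sq]
  nlinarith [Real.pi_lt_d2, Real.pi_pos]

/-- The main term `exp (a λ_n) λ_n⁻² / (4 √3)` of the Hardy–Ramanujan formula. -/
noncomputable def hrMain (n : ℕ) : ℝ :=
  Real.exp (hrConst * hrLambda n) * hrLambda n ^ (-2 : ℤ) / (4 * Real.sqrt 3)

lemma hrMain_pos {n : ℕ} (hn : 1 ≤ n) : 0 < hrMain n := by
  have := le_hrLambda hn
  have : 0 < hrLambda n := by linarith
  unfold hrMain
  positivity

lemma hrMain_eq {n : ℕ} (hn : 1 ≤ n) :
    hrMain n = hrConst / (2 * hrLambda n) / (2 * Real.pi) *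
      (√(hrConst / (2 * hrLambda n) / (2 * Real.pi)) *
        Real.exp (2 * (hrConst * hrLambda n / 2))) * √(Real.pi / (hrConst * hrLambda n / 2)) := by
  have h1 := le_hrLambda hn
  have hl : 0 < hrLambda n := by linarith
  have ha : 0 < hrConst := by linarith [le_hrConst]
  have hpi := Real.pi_pos
  have hs : √(hrConst / (2 * hrLambda n) / (2 * Real.pi)) *
      √(Real.pi / (hrConst * hrLambda n / 2)) = 1 / (√2 * hrLambda n) := by
    rw [← Real.sqrt_mul (by positivity), Real.sqrt_eq_iff_mul_self_eq (by positivity)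
      (by positivity)]
    field_simp
    rw [Real.sq_sqrt (by norm_num)]
  have hc : hrConst = Real.pi * √2 / √3 := by
    rw [hrConst, Real.sqrt_div (by norm_num)]
    ring
  have h2 : √2 ^ 2 = 2 := Real.sq_sqrt (by norm_num)
  calc hrMain n = Real.exp (hrConst * hrLambda n) *
        (hrConst / (2 * hrLambda n) / (2 * Real.pi) * (1 / (√2 * hrLambda n))) := by
        rw [hrMain, zpow_neg, mul_div_assoc]
        congr 1
        rw [hc]
        norm_cast
        field_simp
        norm_num
    _ = _ := by
        rw [← hs, mul_div_cancel₀ _ (two_ne_zero' ℝ)]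
        ring

theorem exists_abs_partitionNumber_sub_hrMain_le : ∃ C : ℝ, 0 < C ∧ ∀ n : ℕ, 1 ≤ n →
    |(partitionNumber n : ℝ) - hrMain n| ≤ C * (√(hrLambda n))⁻¹ * hrMain n := by
  obtain ⟨K, hK0, hK⟩ := exists_norm_integral_sub_le
  refine ⟨K, hK0, fun n hn ↦ ?_⟩
  have h1 := le_hrLambda hn
  have hl : 0 < hrLambda n := by linarith
  have ha1 := le_hrConst
  have ha2 := hrConst_le
  have ha : 0 < hrConst := by linarith
  have hpi := Real.pi_pos
  have heq := hrMain_eq hn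
  -- The saddle point, from π²/(6t) = λ_n² t and a² = 2π²/3. The bounds on a and λ_1 make t ≤ 3/2
  -- and L ≥ 1 hold for every n ≥ 1, so no small n are excluded.
  set t := hrConst / (2 * hrLambda n) with ht
  set L := hrConst * hrLambda n / 2 with hL
  have ht0 : 0 < t := by positivity
  have ht2 : t ≤ 3 / 2 := by
    rw [ht, div_le_iff₀ (by positivity)]; linarith
  have hL1 : 1 ≤ L := by rw [hL]; nlinarith
  have hL0 : 0 < L := by linarith
  have htL : t * L = Real.pi ^ 2 / 6 := by
    rw [ht, hL]
    field_simp
    linarith [hrConst_sq]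
  have hnt : ((n : ℝ) - 1 / 24) * t = L := by
    rw [← hrLambda_sq hn, ht, hL]
    field_simp
  have hmain := hK n t L ht0 ht2 hL1 htL hnt
  have hint := partitionNumber_eq_scaled_integral ht0 n
  change _ = (t : ℂ) * ∫ u in (-(Real.pi / t))..(Real.pi / t), partitionIntegrand n t u at hint
  set J := ∫ u in (-(Real.pi / t))..(Real.pi / t), partitionIntegrand n t u with hJ
  set B : ℝ := √(t / (2 * Real.pi)) * Real.exp (2 * L) with hB
  have hB0 : 0 < B := by
    have : 0 < √(t / (2 * Real.pi)) := Real.sqrt_pos.mpr (by positivity)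
    positivity
  have hdiff : (((partitionNumber n : ℝ) - hrMain n : ℝ) : ℂ) =
      (t / (2 * Real.pi) * B : ℝ) * (J / (B : ℂ) - (√(Real.pi / L) : ℝ)) := by
    have hBc : (B : ℂ) ≠ 0 := by exact_mod_cast hB0.ne'
    have hpic : (Real.pi : ℂ) ≠ 0 := by exact_mod_cast hpi.ne'
    rw [heq]
    push_cast
    field_simp
    linear_combination hint
  rw [← Real.norm_eq_abs, ← Complex.norm_real, hdiff, norm_mul, Complex.norm_real,
    Real.norm_of_nonneg (by positivity)]
  have hKL : K / L ≤ K * (√(hrLambda n))⁻¹ * √(Real.pi / L) := by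
    have e1 : √(Real.pi / L) = √(Real.pi * L) / L := by
      rw [show Real.pi / L = Real.pi * L / L ^ 2 by field_simp, Real.sqrt_div (by positivity),
        Real.sqrt_sq hL0.le]
    have e2 : √(hrLambda n) ≤ √(Real.pi * L) := by
      refine Real.sqrt_le_sqrt ?_
      rw [hL]
      nlinarith [Real.pi_gt_three]
    have e3 : 0 < √(hrLambda n) := Real.sqrt_pos.mpr hl
    have e4 : 1 ≤ (√(hrLambda n))⁻¹ * √(Real.pi * L) := by
      rw [← div_eq_inv_mul, one_le_div e3]
      exact e2
    calc K / L = K / L * 1 := (mul_one _).symm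
      _ ≤ K / L * ((√(hrLambda n))⁻¹ * √(Real.pi * L)) := by gcongr
      _ = _ := by rw [e1]; ring
  calc t / (2 * Real.pi) * B * ‖J / (B : ℂ) - (√(Real.pi / L) : ℝ)‖
      ≤ t / (2 * Real.pi) * B * (K * (√(hrLambda n))⁻¹ * √(Real.pi / L)) := by
        gcongr
        exact hmain.trans hKL
    _ = _ := by rw [heq]; ring

/-! ### Monotonicity of the main term and consecutive differences -/

lemma hrLambda_mono {m n : ℕ} (h : m ≤ n) : hrLambda m ≤ hrLambda n := by
  have : (m : ℝ) ≤ n := by exact_mod_cast h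
  exact Real.sqrt_le_sqrt (by linarith)

lemma hrMain_eq_div_sq (n : ℕ) :
    hrMain n = Real.exp (hrConst * hrLambda n) / hrLambda n ^ 2 / (4 * √3) := by
  rw [hrMain, zpow_neg, ← div_eq_mul_inv]
  norm_cast

lemma hrMain_mono {m n : ℕ} (hm : 1 ≤ m) (h : m ≤ n) : hrMain m ≤ hrMain n := by
  have h1 := le_hrLambda hm
  have h2 := hrLambda_mono h
  have ha := le_hrConst
  rw [hrMain_eq_div_sq, hrMain_eq_div_sq]
  have hl : 0 < hrLambda m := by linarith
  have hl' : 0 < hrLambda n := by linarith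
  gcongr ?_ / _
  rw [div_le_div_iff₀ (by positivity) (by positivity)]
  set d := hrLambda n - hrLambda m with hd
  have hsq : hrLambda n ≤ hrLambda m * Real.exp (hrConst * d / 2) := by
    have h3 := Real.add_one_le_exp (hrConst * d / 2)
    have h4 : d ≤ hrLambda m * (hrConst * d / 2) := by
      -- The function e^(aλ)/λ² increases once aλ ≥ 2, which already holds at λ_1.
      have : 1 ≤ hrLambda m * hrConst / 2 := by nlinarith
      nlinarith
    nlinarith
  have hexp : Real.exp (hrConst * hrLambda n) =
      Real.exp (hrConst * hrLambda m) * Real.exp (hrConst * d / 2) ^ 2 := by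
    rw [← Real.exp_nat_mul, ← Real.exp_add]
    congr 1
    rw [hd]; push_cast; ring
  rw [hexp]
  have : hrLambda n ^ 2 ≤ (hrLambda m * Real.exp (hrConst * d / 2)) ^ 2 := by gcongr
  calc _ ≤ Real.exp (hrConst * hrLambda m) * (hrLambda m * Real.exp (hrConst * d / 2)) ^ 2 := by
        gcongr
    _ = _ := by ring

lemma inv_sqrt_le_mul {a b c : ℝ} (ha : 0 < a) (hb : 0 < b) (hc : 0 ≤ c) (h : a ≤ c ^ 2 * b) :
    (√b)⁻¹ ≤ c * (√a)⁻¹ := by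
  have h1 := Real.sqrt_le_sqrt h
  rw [Real.sqrt_mul (sq_nonneg c), Real.sqrt_sq hc] at h1
  rw [← div_eq_mul_inv, inv_eq_one_div, div_le_div_iff₀ (Real.sqrt_pos.mpr hb)
    (Real.sqrt_pos.mpr ha)]
  linarith

/-- The factor λ^(-2) decreases in λ and only helps, so the relative increment is at most 1 -
e^(-ad) ≤ ad, where d = 1/(λ_{m+1} + λ_m) is the increment of λ. -/
lemma hrMain_succ_sub_le {m : ℕ} (hm : 1 ≤ m) :
    hrMain (m + 1) - hrMain m ≤ 4 * (√(hrLambda (m + 1)))⁻¹ * hrMain (m + 1) := by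
  have h1 := le_hrLambda hm
  have h2 := hrLambda_mono (Nat.le_succ m)
  have ha := hrConst_le
  have ha0 := hrConst_nonneg
  have hM := hrMain_pos (n := m + 1) (by omega)
  have hl : 0 < hrLambda m := by linarith
  have hl' : 0 < hrLambda (m + 1) := by linarith
  set d := hrLambda (m + 1) - hrLambda m with hd
  have hge : (1 - hrConst * d) * hrMain (m + 1) ≤ hrMain m := by
    have h3 : Real.exp (-(hrConst * d)) * hrMain (m + 1) ≤ hrMain m := by
      have : Real.exp (-(hrConst * d)) * Real.exp (hrConst * hrLambda (m + 1)) =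
          Real.exp (hrConst * hrLambda m) := by
        rw [← Real.exp_add]; congr 1; rw [hd]; ring
      rw [hrMain_eq_div_sq, hrMain_eq_div_sq, ← mul_div_assoc, ← mul_div_assoc, this]
      gcongr
    have h4 := Real.add_one_le_exp (-(hrConst * d))
    nlinarith
  have hdle : hrConst * d ≤ 4 * (√(hrLambda (m + 1)))⁻¹ := by
    have h5 : d * (hrLambda (m + 1) + hrLambda m) = 1 := by
      have e1 := hrLambda_sq hm
      have e2 := hrLambda_sq (n := m + 1) (by omega)
      push_cast at e2
      rw [hd]; linear_combination e2 - e1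
    have h6 : d ≤ (hrLambda (m + 1))⁻¹ := by
      rw [inv_eq_one_div, le_div_iff₀ hl']
      nlinarith
    have h7 : (hrLambda (m + 1))⁻¹ ≤ 3 / 2 * (√(hrLambda (m + 1)))⁻¹ := by
      have h8 : (97 / 100 : ℝ) ≤ √(hrLambda (m + 1)) := Real.le_sqrt_of_sq_le (by linarith)
      have h9 := Real.sq_sqrt hl'.le
      generalize √(hrLambda (m + 1)) = s at *
      rw [← h9, ← div_eq_mul_inv, inv_eq_one_div, div_le_div_iff₀ (by positivity) (by linarith)]
      nlinarith
    have h10 : 0 ≤ d := by linarith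
    calc hrConst * d ≤ 13 / 5 * (3 / 2 * (√(hrLambda (m + 1)))⁻¹) :=
          mul_le_mul ha (h6.trans h7) h10 (by norm_num)
      _ ≤ _ := by
        have : 0 ≤ (√(hrLambda (m + 1)))⁻¹ := by positivity
        linarith
  nlinarith

lemma exists_abs_partitionNumber_succ_sub_le : ∃ C : ℝ, 0 < C ∧ ∀ m : ℕ,
    |(partitionNumber (m + 1) : ℝ) - partitionNumber m| ≤
      C * (√(hrLambda (m + 1)))⁻¹ * hrMain (m + 1) := by
  obtain ⟨C, hC0, hC⟩ := exists_abs_partitionNumber_sub_hrMain_le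
  refine ⟨4 + 3 * C, by positivity, fun m ↦ ?_⟩
  have hM := hrMain_pos (n := m + 1) (by omega)
  -- The asymptotics start at index 1, so m = 0 is separate; there p_1 = p_0.
  rcases Nat.eq_zero_or_pos m with rfl | hm
  · have : (partitionNumber (0 + 1) : ℝ) - partitionNumber 0 = 0 := by simp [partitionNumber]
    rw [this, abs_zero]
    positivity
  have h1 := le_hrLambda hm
  have hl : 0 < hrLambda m := by linarith
  have hl' : 0 < hrLambda (m + 1) := by linarith [hrLambda_mono (Nat.le_succ m)]
  have a1 := hC m hm
  have a2 := hC (m + 1) (by omega)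
  have a3 := hrMain_succ_sub_le hm
  have a4 := hrMain_mono hm (Nat.le_succ m)
  have a5 : (√(hrLambda m))⁻¹ ≤ 2 * (√(hrLambda (m + 1)))⁻¹ := by
    refine inv_sqrt_le_mul hl' hl (by norm_num) (le_of_sq_le_sq ?_ (by positivity))
    have e1 := hrLambda_sq hm
    have e2 := hrLambda_sq (n := m + 1) (by omega)
    push_cast at e2
    nlinarith
  have a6 : C * (√(hrLambda m))⁻¹ * hrMain m ≤
      C * (2 * (√(hrLambda (m + 1)))⁻¹) * hrMain (m + 1) := by
    have := hrMain_pos hm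
    gcongr
  have a7 : |hrMain (m + 1) - hrMain m| ≤ 4 * (√(hrLambda (m + 1)))⁻¹ * hrMain (m + 1) := by
    rwa [abs_of_nonneg (by linarith)]
  have hsplit : (partitionNumber (m + 1) : ℝ) - partitionNumber m =
      ((partitionNumber (m + 1) : ℝ) - hrMain (m + 1)) + (hrMain (m + 1) - hrMain m) -
        ((partitionNumber m : ℝ) - hrMain m) := by ring
  rw [hsplit]
  refine (abs_sub _ _).trans ((add_le_add_left (abs_add_le _ _) _).trans ?_)
  linarith

/-! ### Summation by parts and the final estimate -/

/-- Makes the error at index k+1 comparable with that at n; after raising to the fourth power it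
reads n - 1/24 ≤ (n-k)⁴ (k + 1 - 1/24). -/
lemma inv_sqrt_hrLambda_succ_le {k n : ℕ} (h : k < n) :
    (√(hrLambda (k + 1)))⁻¹ ≤ ((n - k : ℕ) : ℝ) * (√(hrLambda n))⁻¹ := by
  obtain ⟨i, rfl⟩ := Nat.exists_eq_add_of_lt h
  have hk := le_hrLambda (n := k + 1) (by omega)
  have hn := le_hrLambda (n := k + i + 1) (by omega)
  refine inv_sqrt_le_mul (by linarith) (by linarith) (by positivity)
    (le_of_sq_le_sq ?_ (mul_nonneg (by positivity) (by linarith)))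
  rw [show k + i + 1 - k = i + 1 by omega, mul_pow, hrLambda_sq (by omega), hrLambda_sq (by omega)]
  push_cast
  have hi : (0 : ℝ) ≤ i := by positivity
  have hk0 : (0 : ℝ) ≤ k := by positivity
  have h1 : ((i : ℝ) + 1) ^ 2 ≤ (((i : ℝ) + 1) ^ 2) ^ 2 :=
    le_self_pow₀ (one_le_pow₀ (by linarith)) two_ne_zero
  have h2 := mul_le_mul_of_nonneg_right h1 (show (0 : ℝ) ≤ k + 1 - 1 / 24 by linarith)
  nlinarith [mul_nonneg hi hk0, mul_nonneg (sq_nonneg (i : ℝ)) hk0]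

lemma sub_one_mul_eval_partitionTaylor (n : ℕ) (x : ℂ) :
    (x - 1) * (partitionTaylor n).eval x = partitionNumber n * x ^ (n + 1) - 1 -
      ∑ k ∈ range n, ((partitionNumber (k + 1) : ℂ) - partitionNumber k) * x ^ (k + 1) := by
  have he : ∀ n, (partitionTaylor n).eval x =
      ∑ k ∈ range (n + 1), (partitionNumber k : ℂ) * x ^ k := fun n ↦ by
    simp [partitionTaylor, Polynomial.eval_finsetSum]
  rw [he]
  induction n with
  | zero => simp [partitionNumber]
  | succ n ih =>
    rw [sum_range_succ, mul_add, ih, sum_range_succ _ n]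
    ring

/-- Since λ_1 < 1, larger exponents do not give smaller powers there; the factor 2 covers this case.
-/
lemma inv_sqrt_le_two_mul_rpow_neg {l η : ℝ} (hl : 97 / 100 ≤ l) (h0 : 0 < η) (h1 : η < 1 / 2) :
    (√l)⁻¹ ≤ 2 * l ^ (-η) := by
  have hl0 : 0 < l := by linarith
  rcases le_total 1 l with h | h
  · have : (√l)⁻¹ ≤ l ^ (-η) := by
      rw [Real.sqrt_eq_rpow, ← Real.rpow_neg hl0.le]
      exact Real.rpow_le_rpow_of_exponent_le h (by linarith)
    have : 0 < l ^ (-η) := Real.rpow_pos_of_pos hl0 _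
    linarith
  · have h2 : 1 ≤ l ^ (-η) := Real.one_le_rpow_of_pos_of_le_one_of_nonpos hl0 h (by linarith)
    have h3 : (√l)⁻¹ ≤ 2 := by
      rw [inv_eq_one_div, div_le_iff₀ (Real.sqrt_pos.mpr hl0)]
      have : (1 / 2 : ℝ) ≤ √l := Real.le_sqrt_of_sq_le (by linarith)
      linarith
    linarith

lemma sum_range_sub_mul_pow_le {ρ : ℝ} (h0 : 0 ≤ ρ) (h1 : ρ < 1) (n : ℕ) :
    ∑ k ∈ range n, ((n - k : ℕ) : ℝ) * ρ ^ (n - k) ≤ ∑' j : ℕ, (j : ℝ) * ρ ^ j := by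
  have hs : Summable fun j : ℕ ↦ (j : ℝ) * ρ ^ j := by
    simpa using summable_pow_mul_geometric_of_norm_lt_one (R := ℝ) 1
      (r := ρ) (by rwa [Real.norm_of_nonneg h0])
  refine le_trans (le_of_eq ?_) (hs.sum_le_tsum (range (n + 1)) fun _ _ ↦ by positivity)
  rw [sum_range_succ', ← sum_range_reflect]
  simp only [Nat.cast_zero, zero_mul, add_zero]
  refine sum_congr rfl fun k hk ↦ ?_
  rw [show n - (n - 1 - k) = k + 1 by simp at hk; omega]

theorem mainTheorem2 (δ : ℝ) (hδ : 0 < δ) :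
    ∃ C : ℝ, ∀ η : ℝ, 0 < η → η < 1 / 2 → ∀ n : ℕ, 1 ≤ n → ∀ x : ℂ, 1 + δ ≤ ‖x‖ →
      ∃ E : ℂ, ‖E‖ ≤ C * hrLambda n ^ (-η) ∧
        (partitionTaylor n).eval x =
          x ^ (n + 1) / (x - 1) *
            ((Real.exp (hrConst * hrLambda n) * hrLambda n ^ (-2 : ℤ) / (4 * Real.sqrt 3) : ℝ) : ℂ)
              * (1 + E) := by
  obtain ⟨A, hA0, hA⟩ := exists_abs_partitionNumber_sub_hrMain_le
  obtain ⟨D, hD0, hD⟩ := exists_abs_partitionNumber_succ_sub_le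
  set ρ : ℝ := (1 + δ)⁻¹ with hρ
  have hρ0 : 0 < ρ := by positivity
  have hρ1 : ρ < 1 := inv_lt_one_of_one_lt₀ (by linarith)
  set W : ℝ := ∑' j : ℕ, (j : ℝ) * ρ ^ j with hW
  have hW0 : 0 ≤ W := tsum_nonneg fun j ↦ by positivity
  have hM1 := hrMain_pos le_rfl
  refine ⟨2 * (A + W / hrMain 1 + D * W), fun η hη0 hη1 n hn x hx ↦ ?_⟩
  have hx0 : x ≠ 0 := by
    rw [← norm_pos_iff]; linarith
  have hx1 : x - 1 ≠ 0 := by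
    intro h
    rw [sub_eq_zero.mp h, norm_one] at hx
    linarith
  have hxρ : ‖x‖⁻¹ ≤ ρ := inv_anti₀ (by linarith) hx
  have hM := hrMain_pos hn
  have hMc : (hrMain n : ℂ) ≠ 0 := by exact_mod_cast hM.ne'
  have hl := le_hrLambda hn
  have hl0 : 0 < hrLambda n := by linarith
  set s := (√(hrLambda n))⁻¹ with hs
  have hs0 : 0 < s := inv_pos.mpr (Real.sqrt_pos.mpr hl0)
  -- N is (x-1) s_n(x) / x^(n+1) minus the main term.
  set N : ℂ := ((partitionNumber n : ℝ) - hrMain n : ℝ) - (x⁻¹) ^ (n + 1) -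
    ∑ k ∈ range n, ((partitionNumber (k + 1) : ℂ) - partitionNumber k) * (x⁻¹) ^ (n - k) with hN
  refine ⟨N / hrMain n, ?_, ?_⟩
  · have b1 : ‖(((partitionNumber n : ℝ) - hrMain n : ℝ) : ℂ)‖ ≤ A * s * hrMain n := by
      rw [Complex.norm_real, Real.norm_eq_abs]
      exact hA n hn
    have b2 : ‖(x⁻¹) ^ (n + 1)‖ ≤ W / hrMain 1 * s * hrMain n := by
      have c1 : ‖(x⁻¹) ^ (n + 1)‖ ≤ ρ ^ (n + 1) := by
        rw [norm_pow, norm_inv]; gcongr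
      -- The boundary term x^(-(n+1)) is compared with the j = n+1 term of W; the factor (n+1)s ≥ 1
      -- supplies the required decay rate, and the main term is at least its value at 1.
      have c2 : ((n + 1 : ℕ) : ℝ) * ρ ^ (n + 1) ≤ W := by
        refine le_trans ?_ (sum_range_sub_mul_pow_le hρ0.le hρ1 (n + 1))
        exact single_le_sum (f := fun k ↦ ((n + 1 - k : ℕ) : ℝ) * ρ ^ (n + 1 - k))
          (fun _ _ ↦ by positivity) (mem_range.mpr (Nat.succ_pos n))
      have c3 : 1 ≤ ((n + 1 : ℕ) : ℝ) * s := by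
        have hn1 : (1 : ℝ) ≤ n := by exact_mod_cast hn
        have c4 : √(hrLambda n) ≤ ((n + 1 : ℕ) : ℝ) := by
          rw [Real.sqrt_le_left (by positivity)]
          refine le_of_sq_le_sq ?_ (by positivity)
          rw [hrLambda_sq hn]
          push_cast
          have : ((n : ℝ) + 1) ^ 2 ≤ (((n : ℝ) + 1) ^ 2) ^ 2 :=
            le_self_pow₀ (one_le_pow₀ (by linarith)) two_ne_zero
          nlinarith
        rwa [hs, ← div_eq_mul_inv, one_le_div (Real.sqrt_pos.mpr hl0)]
      have c5 : 1 ≤ hrMain n / hrMain 1 := (one_le_div hM1).mpr (hrMain_mono le_rfl hn)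
      calc ‖(x⁻¹) ^ (n + 1)‖ ≤ ρ ^ (n + 1) := c1
        _ ≤ ρ ^ (n + 1) * (((n + 1 : ℕ) : ℝ) * s) := le_mul_of_one_le_right (by positivity) c3
        _ = ((n + 1 : ℕ) : ℝ) * ρ ^ (n + 1) * s := by ring
        _ ≤ W * s := by gcongr
        _ ≤ W * s * (hrMain n / hrMain 1) := le_mul_of_one_le_right (by positivity) c5
        _ = _ := by ring
    have b3 : ‖∑ k ∈ range n, ((partitionNumber (k + 1) : ℂ) - partitionNumber k) *
        (x⁻¹) ^ (n - k)‖ ≤ D * W * s * hrMain n := by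
      calc _ ≤ ∑ k ∈ range n, D * s * hrMain n * (((n - k : ℕ) : ℝ) * ρ ^ (n - k)) := by
            refine norm_sum_le_of_le _ fun k hk ↦ ?_
            have hkn := mem_range.mp hk
            have d1 : ‖(partitionNumber (k + 1) : ℂ) - partitionNumber k‖ ≤
                D * (((n - k : ℕ) : ℝ) * s) * hrMain n := by
              have : (partitionNumber (k + 1) : ℂ) - partitionNumber k =
                  (((partitionNumber (k + 1) : ℝ) - partitionNumber k : ℝ) : ℂ) := by push_cast; rfl
              rw [this, Complex.norm_real, Real.norm_eq_abs]
              refine (hD k).trans ?_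
              have := hrMain_mono (Nat.le_add_left 1 k) hkn
              have := inv_sqrt_hrLambda_succ_le hkn
              have := hrMain_pos (Nat.le_add_left 1 k)
              gcongr
            have d2 : ‖(x⁻¹) ^ (n - k)‖ ≤ ρ ^ (n - k) := by
              rw [norm_pow, norm_inv]; gcongr
            rw [norm_mul]
            calc _ ≤ D * (((n - k : ℕ) : ℝ) * s) * hrMain n * ρ ^ (n - k) := by gcongr
              _ = _ := by ring
        _ = D * s * hrMain n * ∑ k ∈ range n, ((n - k : ℕ) : ℝ) * ρ ^ (n - k) := by rw [mul_sum]
        _ ≤ D * s * hrMain n * W := by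
            gcongr
            exact sum_range_sub_mul_pow_le hρ0.le hρ1 n
        _ = _ := by ring
    rw [norm_div, Complex.norm_real, Real.norm_of_nonneg hM.le, div_le_iff₀ hM]
    have hη := inv_sqrt_le_two_mul_rpow_neg hl hη0 hη1
    rw [← hs] at hη
    calc ‖N‖ ≤ A * s * hrMain n + W / hrMain 1 * s * hrMain n + D * W * s * hrMain n :=
          (norm_sub_le _ _).trans (add_le_add ((norm_sub_le _ _).trans (add_le_add b1 b2)) b3)
      _ = (A + W / hrMain 1 + D * W) * s * hrMain n := by ring
      _ ≤ (A + W / hrMain 1 + D * W) * (2 * hrLambda n ^ (-η)) * hrMain n := by gcongr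
      _ = _ := by ring
  · change _ = x ^ (n + 1) / (x - 1) * (hrMain n : ℂ) * (1 + N / hrMain n)
    have h := sub_one_mul_eval_partitionTaylor n x
    have e1 : x ^ (n + 1) * (x⁻¹) ^ (n + 1) = 1 := by
      rw [← mul_pow, mul_inv_cancel₀ hx0, one_pow]
    have e2 : x ^ (n + 1) * ∑ k ∈ range n, ((partitionNumber (k + 1) : ℂ) - partitionNumber k) *
        (x⁻¹) ^ (n - k) =
        ∑ k ∈ range n, ((partitionNumber (k + 1) : ℂ) - partitionNumber k) * x ^ (k + 1) := by
      rw [mul_sum]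
      refine sum_congr rfl fun k hk ↦ ?_
      have hkn := mem_range.mp hk
      have : x ^ (n + 1) = x ^ (k + 1) * x ^ (n - k) := by
        rw [← pow_add]; congr 1; omega
      rw [this, mul_left_comm, mul_assoc (x ^ (k + 1)), ← mul_pow, mul_inv_cancel₀ hx0, one_pow,
        mul_one]
    have e3 : (hrMain n : ℂ) * (1 + N / hrMain n) = hrMain n + N := by
      field_simp
    rw [mul_assoc, e3, div_mul_eq_mul_div, eq_div_iff hx1, mul_comm, h, hN]
    push_cast
    linear_combination e1 + e2
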